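/- Let $d\ge 2$ and let $\Phi$ be a point process on $\mathbb R^d$, i.e. a measurable random element of the space of counting measures on $\mathbb R^d$ that are finite on bounded sets, with the $\sigma$-algebra generated by the evaluations $\mu\mapsto\mu(B)$, $B$ bounded Borel. Multiple points are allowed. Assume that $\Phi$ is stationary (its law is invariant under all translations), that it has intensity $\lambda\in(0,\infty)$, i.e. $\mathbb E\,\Phi(B)=\lambda|B|$ for every bounded Borel set $B$ (with $|B|$ its Lebesgue measure), and that it is weakly sub-Poisson, i.e. $$\mathbb P(\Phi(B)=0)\le e^{-\mathbb E\Phi(B)},\qquad \mathbb E\Big[\prod_{i=1}^k\Phi(B_i)\Big]\le\prod_{i=1}^k\mathbb E\,\Phi(B_i)$$ for every bounded Borel set $B$ and all $k\geq 1$ and mutually disjoint bounded Borel sets $B_1,\dots,B_k$. For $r\ge0$ let $C(\Phi,r)=\bigcup_{X\in\Phi}B_r(X)$ be the union of the closed Euclidean balls of radius $r$ centred at the points of $\Phi$; a set percolates if it contains an unbounded connected subset. Let $$r_c(\Phi)=\inf\{r\ge0:\ \mathbb P(C(\Phi,r)\text{ percolates})>0\}\in[0,\infty],$$ and let $\theta_d$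 be the volume of the unit ball of $\mathbb R^d$. Then $$0<\frac{1}{2\,(\lambda\,\theta_d)^{1/d}}\ \le\ r_c(\Phi)\ \le\ \sqrt d\,\Big(\frac{\log(3^d-2)}{\lambda}\Big)^{1/d}<\infty .$$ -/

import Mathlib

open MeasureTheory ProbabilityTheory Set
open scoped ENNReal

noncomputable section

/-- The space `N(ℝ^d)` of Radon (finite on bounded sets) counting measures on `ℝ^d`:
the value on every bounded Borel set is a natural number. Multiple points are allowed. -/
structure CountingConfig (d : ℕ) where
  toMeasure : Measure (EuclideanSpace ℝ (Fin d))
  counting : ∀ B : Set (EuclideanSpace ℝ (Fin d)), Bornology.IsBounded B → MeasurableSet B →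
    ∃ n : ℕ, toMeasure B = (n : ℝ≥0∞)

namespace CountingConfig

variable {d : ℕ}

/-- The σ-algebra generated by the maps `μ ↦ μ(B)`, for `B` a bounded Borel set. -/
instance : MeasurableSpace (CountingConfig d) :=
  ⨆ (B : Set (EuclideanSpace ℝ (Fin d))) (_ : Bornology.IsBounded B) (_ : MeasurableSet B),
    MeasurableSpace.comap (fun μ : CountingConfig d => μ.toMeasure B) inferInstance

theorem measurable_apply {B : Set (EuclideanSpace ℝ (Fin d))} (hb : Bornology.IsBounded B)
    (hB : MeasurableSet B) : Measurable (fun μ : CountingConfig d => μ.toMeasure B) := by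
  refine Measurable.mono (comap_measurable _) ?_ le_rfl
  exact le_iSup_of_le B (le_iSup_of_le hb (le_iSup_of_le hB le_rfl))

theorem isBounded_preimage_add {B : Set (EuclideanSpace ℝ (Fin d))}
    (x : EuclideanSpace ℝ (Fin d)) (hb : Bornology.IsBounded B) :
    Bornology.IsBounded ((fun y => y + x) ⁻¹' B) := by
  obtain ⟨C, hC⟩ := hb.exists_norm_le
  refine isBounded_iff_forall_norm_le.2 ⟨C + ‖x‖, fun y hy => ?_⟩
  have h1 := hC _ hy
  have h2 : ‖y‖ ≤ ‖y + x‖ + ‖x‖ := by simpa using norm_sub_le (y + x) x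
  linarith

/-- Translation of all the points of a configuration by the vector `x`. -/
def translate (x : EuclideanSpace ℝ (Fin d)) (μ : CountingConfig d) : CountingConfig d where
  toMeasure := μ.toMeasure.map (fun y => y + x)
  counting B hb hB := by
    rw [Measure.map_apply (measurable_add_const x) hB]
    exact μ.counting _ (isBounded_preimage_add x hb) (measurable_add_const x hB)

theorem measurable_translate (x : EuclideanSpace ℝ (Fin d)) :
    Measurable (translate (d := d) x) := by
  rw [measurable_iff_comap_le, instMeasurableSpace]
  simp only [MeasurableSpace.comap_iSup, MeasurableSpace.comap_comp, iSup_le_iff]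
  intro B hb hB
  rw [← measurable_iff_comap_le]
  have h : ((fun μ : CountingConfig d => μ.toMeasure B) ∘ translate x)
      = fun μ => μ.toMeasure ((fun y => y + x) ⁻¹' B) := by
    funext μ
    exact Measure.map_apply (measurable_add_const x) hB
  rw [h]
  exact measurable_apply (isBounded_preimage_add x hb) (measurable_add_const x hB)

/-- The coverage number `V_r(y) = ∑ 1[y ∈ B_r(X)]`, the sum running over the points `X` of the
configuration with multiplicity; `B_r(X)` is the closed Euclidean ball. -/
def coverage (μ : CountingConfig d) (r : ℝ) (y : EuclideanSpace ℝ (Fin d)) : ℝ≥0∞ :=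
  ∫⁻ x, (Metric.closedBall x r).indicator (fun _ => 1) y ∂μ.toMeasure

theorem coverage_eq (μ : CountingConfig d) (r : ℝ) (y : EuclideanSpace ℝ (Fin d)) :
    μ.coverage r y = μ.toMeasure (Metric.closedBall y r) := by
  rw [coverage, ← lintegral_indicator_one Metric.isClosed_closedBall.measurableSet]
  refine lintegral_congr fun x => ?_
  simp only [indicator, Metric.mem_closedBall, dist_comm, Pi.one_apply]

/-- The `k`-covered set; for `k = 1` it is the Boolean model, the union of the balls. -/
def coveredSet (k : ℕ) (μ : CountingConfig d) (r : ℝ) : Set (EuclideanSpace ℝ (Fin d)) :=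
  {y | (k : ℝ≥0∞) ≤ μ.coverage r y}

end CountingConfig

/-- A set percolates if it contains an unbounded connected subset. -/
def Percolates {d : ℕ} (S : Set (EuclideanSpace ℝ (Fin d))) : Prop :=
  ∃ T ⊆ S, IsConnected T ∧ ¬ Bornology.IsBounded T

section PointProcess

variable {Ω : Type*} [MeasurableSpace Ω] {d : ℕ}

/-- The critical radius for `k`-percolation, an infimum in `[0, ∞]` (it is `∞` if no radius
gives percolation with positive probability). -/
def criticalRadius (P : Measure Ω) (Φ : Ω → CountingConfig d) (k : ℕ) : ℝ≥0∞ :=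
  sInf {R | ∃ r : ℝ, 0 ≤ r ∧ R = ENNReal.ofReal r ∧
    0 < P {ω | Percolates ((Φ ω).coveredSet k r)}}

/-- Stationarity: the law is invariant under all translations. -/
def IsStationaryProcess (P : Measure Ω) (Φ : Ω → CountingConfig d) : Prop :=
  ∀ x : EuclideanSpace ℝ (Fin d), IdentDistrib (fun ω => (Φ ω).translate x) Φ P P

/-- The mean measure is `lam` times Lebesgue measure. -/
def HasIntensity (P : Measure Ω) (Φ : Ω → CountingConfig d) (lam : ℝ) : Prop :=
  ∀ B : Set (EuclideanSpace ℝ (Fin d)), Bornology.IsBounded B → MeasurableSet B →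
    ∫⁻ ω, (Φ ω).toMeasure B ∂P = ENNReal.ofReal lam * volume B

/-- `P(Φ(B) = 0) ≤ exp(-E Φ(B))` for all bounded Borel sets `B`. -/
def IsNuWeaklySubPoisson (P : Measure Ω) (Φ : Ω → CountingConfig d) : Prop :=
  ∀ B : Set (EuclideanSpace ℝ (Fin d)), Bornology.IsBounded B → MeasurableSet B →
    P {ω | (Φ ω).toMeasure B = 0} ≤
      EReal.exp (-((∫⁻ ω, (Φ ω).toMeasure B ∂P : ℝ≥0∞) : EReal))

/-- `E ∏ Φ(B_i) ≤ ∏ E Φ(B_i)` for all mutually disjoint bounded Borel sets `B_i`. -/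
def IsAlphaWeaklySubPoisson (P : Measure Ω) (Φ : Ω → CountingConfig d) : Prop :=
  ∀ (k : ℕ) (B : Fin k → Set (EuclideanSpace ℝ (Fin d))),
    (∀ i, Bornology.IsBounded (B i)) → (∀ i, MeasurableSet (B i)) →
    (∀ i j, i ≠ j → Disjoint (B i) (B j)) →
    ∫⁻ ω, ∏ i, (Φ ω).toMeasure (B i) ∂P ≤ ∏ i, ∫⁻ ω, (Φ ω).toMeasure (B i) ∂P

/-- Weakly sub-Poisson: both void probabilities and moment measures are dominated. -/
def IsWeaklySubPoisson (P : Measure Ω) (Φ : Ω → CountingConfig d) : Prop :=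
  IsNuWeaklySubPoisson P Φ ∧ IsAlphaWeaklySubPoisson P Φ

end PointProcess

/-- The volume `θ_d` of the Euclidean unit ball of `ℝ^d`. -/
def unitBallVolume (d : ℕ) : ℝ :=
  (volume (Metric.ball (0 : EuclideanSpace ℝ (Fin d)) 1)).toReal

end

/-! Both bounds are Peierls arguments: space is cut into half-open cubes of side `s`, and the two
halves of weak sub-Poissonianity replace independence between distinct cubes.

Lower bound. If the balls of radius `r` percolate, the unbounded connected set lies in the balls of
radius `R = r + √d s` around the corners of one component of occupied cubes, two cubes being
adjacent when their corners are within `2R` (`exists_chains_of_percolates`). Hence some cube starts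
self-avoiding chains of occupied cubes of every length. The moment inequality and Markov bound the
probability that `n + 1` given distinct cubes are all occupied by `(λ s^d)^(n+1)`, and a volume
comparison bounds the number of neighbours, so the probability of an `n`-step chain decays
geometrically once `λ θ_d (2r + 3√d s)^d < 1`. For small `s` this allows every `r` with `λ θ_d
(2r)^d < 1`.

Upper bound. Only the cubes indexed by a coordinate plane are used. An infinite king-connected
cluster of occupied cubes percolates at radius `√d s`. If all such clusters are finite, planar
duality (`exists_rook_path_of_finite`) yields, for every `M`, a self-avoiding rook-chain of `k > M`
steps through vacant cubes, starting at `(k, 0)`. The void inequality, applied to the union of the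
cubes, bounds its probability by `4^k q^(k+1)` with `q = exp(-λ s^d)`. For `4q < 1` the tail of this
series is below 1, so percolation has positive probability; and `4 ≤ 3^d - 2`.

Duality is proved modulo 2: the edges between the finite cluster and a piece of its outer boundary
form a closed cochain on the grid, which therefore has a potential. -/

noncomputable section

/-! ### Chains in a locally finite graph -/

section Chains

variable {V : Type*}

open Classical in
/-- The `n`-step chains starting at `v`, where every vertex is followed by one of its
neighbours. -/
def chains (nbr : V → Finset V) : ℕ → V → Finset (List V)
  | 0, v => {[v]}
  | n + 1, v => (nbr v).biUnion fun w => (chains nbr n w).image (List.cons v)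

theorem card_chains_le {nbr : V → Finset V} {N : ℕ} (hN : ∀ v, (nbr v).card ≤ N) (n : ℕ) (v : V) :
    (chains nbr n v).card ≤ N ^ n := by
  classical
  induction n generalizing v with
  | zero => simp [chains]
  | succ n ih =>
    rw [chains, pow_succ']
    refine (Finset.card_biUnion_le_card_mul _ _ (N ^ n) fun w _ => ?_).trans
      (Nat.mul_le_mul_right _ (hN v))
    exact Finset.card_image_le.trans (ih w)

theorem length_of_mem_chains {nbr : V → Finset V} {n : ℕ} {v : V} {l : List V}
    (hl : l ∈ chains nbr n v) : l.length = n + 1 := by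
  classical
  induction n generalizing v l with
  | zero => simp_all [chains]
  | succ n ih =>
    simp only [chains, Finset.mem_biUnion, Finset.mem_image] at hl
    obtain ⟨w, -, l', hl', rfl⟩ := hl
    simp [ih hl']

theorem exists_mem_chains_of_walk {G : SimpleGraph V} {nbr : V → Finset V}
    (hG : ∀ u v, G.Adj u v → v ∈ nbr u) {a b : V} (p : G.Walk a b) (n : ℕ) (hn : n ≤ p.length) :
    ∃ l ∈ chains nbr n a, l.Sublist p.support := by
  classical
  induction n generalizing a with
  | zero => exact ⟨[a], by simp [chains], by simp⟩
  | succ n ih =>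
    cases p with
    | nil => simp at hn
    | cons h q =>
      obtain ⟨l, hl, hs⟩ := ih q (by simpa using hn)
      refine ⟨a :: l, ?_, by simpa using hs⟩
      simp only [chains, Finset.mem_biUnion, Finset.mem_image]
      exact ⟨_, hG _ _ h, l, hl, rfl⟩

theorem dist_le_mul_walk_length {G : SimpleGraph V} {X : Type*} [PseudoMetricSpace X] (f : V → X)
    {L : ℝ} (hf : ∀ u v, G.Adj u v → dist (f u) (f v) ≤ L) {a b : V} (p : G.Walk a b) :
    dist (f a) (f b) ≤ L * p.length := by
  induction p with
  | nil => simp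
  | cons h q ih =>
    have := dist_triangle (f _) (f _) (f _) |>.trans (add_le_add (hf _ _ h) ih)
    refine this.trans (le_of_eq ?_)
    rw [SimpleGraph.Walk.length_cons]; push_cast; ring

theorem mem_of_mem_walk_support {G : SimpleGraph V} {A : Set V}
    (hG : ∀ u v, G.Adj u v → v ∈ A) {a b : V} (ha : a ∈ A) (p : G.Walk a b) :
    ∀ x ∈ p.support, x ∈ A := by
  induction p with
  | nil => simpa using ha
  | cons h q ih =>
    intro x hx
    rw [SimpleGraph.Walk.support_cons, List.mem_cons] at hx
    rcases hx with rfl | hx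
    · exact ha
    · exact ih (hG _ _ h) x hx

/-- Two vertices joined inside `A` and far apart are joined by a long self-avoiding chain. -/
theorem exists_nodup_chain {G : SimpleGraph V} {nbr : V → Finset V} {A : Set V}
    (hG : ∀ u v, G.Adj u v → v ∈ nbr u ∧ v ∈ A) {X : Type*} [PseudoMetricSpace X] (f : V → X)
    {L : ℝ} (hL : 0 < L) (hf : ∀ u v, G.Adj u v → dist (f u) (f v) ≤ L) {a b : V} (ha : a ∈ A)
    (hab : G.Reachable a b) (n : ℕ) (hn : L * n ≤ dist (f a) (f b)) :
    ∃ l ∈ chains nbr n a, l.Nodup ∧ ∀ x ∈ l, x ∈ A := by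
  classical
  obtain ⟨p⟩ := hab
  have h1 := dist_le_mul_walk_length f hf (p.toPath : G.Walk a b)
  have h2 : n ≤ (p.toPath : G.Walk a b).length := by
    have := le_of_mul_le_mul_left (hn.trans h1) hL
    exact_mod_cast this
  obtain ⟨l, hl, hs⟩ := exists_mem_chains_of_walk (fun u v h => (hG u v h).1) _ n h2
  exact ⟨l, hl, hs.nodup p.toPath.2.support_nodup, fun x hx =>
    mem_of_mem_walk_support (fun u v h => (hG u v h).2) ha _ x (hs.subset hx)⟩

/-- Union bound over chains. Only chains without repetition are counted, since the sub-Poisson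
estimates concern distinct cells; `n` steps visit `n + 1` vertices, whence the exponent of `p`. -/
theorem measure_exists_chain_le {Ω : Type*} [MeasurableSpace Ω] (P : Measure Ω) (A : Ω → Set V)
    {p : ℝ≥0∞} (hA : ∀ l : List V, l.Nodup → P {ω | ∀ x ∈ l, x ∈ A ω} ≤ p ^ l.length)
    {nbr : V → Finset V} {N : ℕ} (hN : ∀ v, (nbr v).card ≤ N) (n : ℕ) (v : V) :
    P {ω | ∃ l ∈ chains nbr n v, l.Nodup ∧ ∀ x ∈ l, x ∈ A ω} ≤ (N : ℝ≥0∞) ^ n * p ^ (n + 1) := by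
  classical
  have hsub : {ω | ∃ l ∈ chains nbr n v, l.Nodup ∧ ∀ x ∈ l, x ∈ A ω} ⊆
      ⋃ l ∈ (chains nbr n v).filter List.Nodup, {ω | ∀ x ∈ l, x ∈ A ω} := by
    rintro ω ⟨l, hl, hd, hx⟩
    simp only [mem_iUnion]
    exact ⟨l, by simp [hl, hd], hx⟩
  refine (measure_mono hsub).trans ((measure_biUnion_finset_le _ _).trans ?_)
  have : ∀ l ∈ (chains nbr n v).filter List.Nodup, P {ω | ∀ x ∈ l, x ∈ A ω} ≤ p ^ (n + 1) := by
    intro l hl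
    rw [Finset.mem_filter] at hl
    rw [← length_of_mem_chains hl.1]
    exact hA l hl.2
  refine (Finset.sum_le_sum this).trans ?_
  rw [Finset.sum_const, nsmul_eq_mul]
  gcongr
  calc (((chains nbr n v).filter List.Nodup).card : ℝ≥0∞) ≤ ((N ^ n : ℕ) : ℝ≥0∞) := by
        exact_mod_cast (Finset.card_filter_le _ _).trans (card_chains_le hN n v)
    _ = (N : ℝ≥0∞) ^ n := by push_cast; rfl

end Chains

/-! ### The partition of space into half-open cubes -/

section Cells

variable {d : ℕ}

/-- The lattice point `s z`. -/
def corner (s : ℝ) (z : Fin d → ℤ) : EuclideanSpace ℝ (Fin d) := WithLp.toLp 2 fun i => s * z i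

/-- The half-open cube of side `s` with lower corner `s z`. -/
def cell (s : ℝ) (z : Fin d → ℤ) : Set (EuclideanSpace ℝ (Fin d)) :=
  {y | ∀ i, s * z i ≤ y i ∧ y i < s * (z i + 1)}

/-- The closed cube of side `s` with lower corner `s z`. -/
def closedCell (s : ℝ) (z : Fin d → ℤ) : Set (EuclideanSpace ℝ (Fin d)) :=
  {y | ∀ i, s * z i ≤ y i ∧ y i ≤ s * (z i + 1)}

theorem cell_subset_closedCell (s : ℝ) (z : Fin d → ℤ) : cell s z ⊆ closedCell s z :=
  fun _ hy i => ⟨(hy i).1, (hy i).2.le⟩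

theorem corner_mem_closedCell {s : ℝ} (hs : 0 < s) (z : Fin d → ℤ) :
    corner s z ∈ closedCell s z := fun i => by
  simp only [corner]
  constructor <;> nlinarith

theorem dist_le_sqrt_mul {x y : EuclideanSpace ℝ (Fin d)} {s : ℝ} (hs : 0 ≤ s)
    (h : ∀ i, |x i - y i| ≤ s) : dist x y ≤ √d * s := by
  rw [EuclideanSpace.dist_eq, Real.sqrt_le_left (by positivity), mul_pow,
    Real.sq_sqrt (Nat.cast_nonneg d)]
  calc ∑ i, dist (x i) (y i) ^ 2 ≤ ∑ _i : Fin d, s ^ 2 := by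
        refine Finset.sum_le_sum fun i _ => ?_
        rw [Real.dist_eq]
        exact pow_le_pow_left₀ (abs_nonneg _) (h i) 2
    _ = d * s ^ 2 := by simp

theorem dist_le_of_mem_closedCell {s : ℝ} (hs : 0 < s) {z : Fin d → ℤ}
    {x y : EuclideanSpace ℝ (Fin d)} (hx : x ∈ closedCell s z) (hy : y ∈ closedCell s z) :
    dist x y ≤ √d * s := by
  refine dist_le_sqrt_mul hs.le fun i => abs_le.2 ?_
  have h1 := hx i
  have h2 := hy i
  constructor <;> linarith

theorem isBounded_cell {s : ℝ} (hs : 0 < s) (z : Fin d → ℤ) : Bornology.IsBounded (cell s z) :=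
  Metric.isBounded_iff.2 ⟨√d * s, fun _ hx _ hy => dist_le_of_mem_closedCell hs
    (cell_subset_closedCell s z hx) (cell_subset_closedCell s z hy)⟩

theorem cell_eq_preimage (s : ℝ) (z : Fin d → ℤ) :
    cell s z = (MeasurableEquiv.toLp 2 (Fin d → ℝ)).symm ⁻¹'
      (univ.pi fun i => Ico (s * z i) (s * (z i + 1))) := by
  ext y
  simp [cell]

theorem measurableSet_cell (s : ℝ) (z : Fin d → ℤ) : MeasurableSet (cell s z) := by
  rw [cell_eq_preimage]
  exact (MeasurableEquiv.measurable _) (MeasurableSet.univ_pi fun i => measurableSet_Ico)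

theorem volume_cell (s : ℝ) (z : Fin d → ℤ) : volume (cell s z) = ENNReal.ofReal s ^ d := by
  rw [cell_eq_preimage]
  rw [(EuclideanSpace.volume_preserving_symm_measurableEquiv_toLp (Fin d)).measure_preimage
    (MeasurableSet.univ_pi fun i => measurableSet_Ico).nullMeasurableSet, Real.volume_pi_Ico]
  simp [mul_add]

theorem eq_of_mem_cell {s : ℝ} (hs : 0 < s) {z w : Fin d → ℤ} {y : EuclideanSpace ℝ (Fin d)}
    (hz : y ∈ cell s z) (hw : y ∈ cell s w) : z = w := by
  funext i
  have h1 := (hz i).1.trans_lt (hw i).2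
  have h2 := (hw i).1.trans_lt (hz i).2
  have h3 : (z i : ℝ) < w i + 1 := lt_of_mul_lt_mul_left h1 hs.le
  have h4 : (w i : ℝ) < z i + 1 := lt_of_mul_lt_mul_left h2 hs.le
  have h5 : z i < w i + 1 := by exact_mod_cast h3
  have h6 : w i < z i + 1 := by exact_mod_cast h4
  omega

theorem disjoint_cell {s : ℝ} (hs : 0 < s) {z w : Fin d → ℤ} (h : z ≠ w) :
    Disjoint (cell s z) (cell s w) :=
  disjoint_left.2 fun _ hz hw => h (eq_of_mem_cell hs hz hw)

theorem exists_mem_cell {s : ℝ} (hs : 0 < s) (y : EuclideanSpace ℝ (Fin d)) :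
    ∃ z, y ∈ cell s z := by
  refine ⟨fun i => ⌊y i / s⌋, fun i => ⟨?_, ?_⟩⟩
  · have := Int.floor_le (y i / s)
    rw [le_div_iff₀ hs] at this
    linarith
  · have := Int.lt_floor_add_one (y i / s)
    rw [div_lt_iff₀ hs] at this
    linarith

theorem volume_biUnion_cell {s : ℝ} (hs : 0 < s) (F : Finset (Fin d → ℤ)) :
    volume (⋃ z ∈ F, cell s z) = F.card * ENNReal.ofReal s ^ d := by
  rw [measure_biUnion_finset (fun z _ w _ h => disjoint_cell hs h)
    fun z _ => measurableSet_cell s z]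
  simp [volume_cell]

/-- A bound on the number of lattice points in a ball. -/
theorem card_corner_le {s : ℝ} (hs : 0 < s) (x : EuclideanSpace ℝ (Fin d)) {ρ : ℝ}
    (F : Finset (Fin d → ℤ)) (hF : ∀ z ∈ F, dist (corner s z) x ≤ ρ) :
    F.card * ENNReal.ofReal s ^ d ≤ volume (Metric.closedBall x (ρ + √d * s)) := by
  rw [← volume_biUnion_cell hs]
  refine measure_mono (iUnion₂_subset fun z hz y hy => ?_)
  have h1 := dist_le_of_mem_closedCell hs (cell_subset_closedCell s z hy)
    (corner_mem_closedCell hs z)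
  have h2 := hF z hz
  rw [Metric.mem_closedBall]
  linarith [dist_triangle y (corner s z) x]

theorem finite_setOf_dist_corner_le {s : ℝ} (hs : 0 < s) (x : EuclideanSpace ℝ (Fin d)) (ρ : ℝ) :
    {z : Fin d → ℤ | dist (corner s z) x ≤ ρ}.Finite := by
  by_contra hinf
  have hs' : ENNReal.ofReal s ^ d ≠ 0 := pow_ne_zero _ (by simpa using hs)
  have hs'' : ENNReal.ofReal s ^ d ≠ ∞ := ENNReal.pow_ne_top ENNReal.ofReal_ne_top
  have hv : volume (Metric.closedBall x (ρ + √d * s)) / ENNReal.ofReal s ^ d ≠ ∞ :=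
    ENNReal.div_ne_top Metric.isBounded_closedBall.measure_lt_top.ne hs'
  obtain ⟨n, hn⟩ := ENNReal.exists_nat_gt hv
  obtain ⟨F, hF, hc⟩ := Set.Infinite.exists_subset_card_eq hinf n
  have h1 := card_corner_le hs x F (fun z hz => hF hz)
  rw [hc] at h1
  rw [ENNReal.div_lt_iff (Or.inl hs') (Or.inl hs'')] at hn
  exact absurd h1 (not_le.2 hn)

theorem locallyFinite_closedBall_corner {s : ℝ} (hs : 0 < s) (R : ℝ) :
    LocallyFinite fun z : Fin d → ℤ => Metric.closedBall (corner s z) R := by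
  intro x
  refine ⟨Metric.ball x 1, Metric.ball_mem_nhds x one_pos,
    (finite_setOf_dist_corner_le hs x (R + 1)).subset ?_⟩
  rintro z ⟨y, hy, hy'⟩
  rw [Metric.mem_closedBall, dist_comm] at hy
  rw [Metric.mem_ball] at hy'
  have := dist_triangle (corner s z) y x
  change dist (corner s z) x ≤ R + 1
  linarith

/-- Closedness of possibly infinite unions allows a connected set to be separated by a two-piece
closed cover. -/
theorem isClosed_biUnion_closedBall_corner {s : ℝ} (hs : 0 < s) (R : ℝ) (S : Set (Fin d → ℤ)) :
    IsClosed (⋃ z ∈ S, Metric.closedBall (corner s z) R) := by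
  rw [biUnion_eq_iUnion]
  exact ((locallyFinite_closedBall_corner hs R).comp_injective
    Subtype.val_injective).isClosed_iUnion fun _ => Metric.isClosed_closedBall

end Cells

/-! ### Planar duality: a finite king-connected set is surrounded by a rook-path -/

section Planar

/-- Equal or adjacent, diagonals included. -/
def King (u v : ℤ × ℤ) : Prop := |u.1 - v.1| ≤ 1 ∧ |u.2 - v.2| ≤ 1

/-- Equal or adjacent, diagonals excluded. -/
def Rook (u v : ℤ × ℤ) : Prop :=
  (u.2 = v.2 ∧ |u.1 - v.1| ≤ 1) ∨ (u.1 = v.1 ∧ |u.2 - v.2| ≤ 1)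

theorem King.symm {u v : ℤ × ℤ} (h : King u v) : King v u := by
  simpa only [King, abs_sub_comm] using h

theorem Rook.symm {u v : ℤ × ℤ} (h : Rook u v) : Rook v u := by
  simpa only [Rook, abs_sub_comm, eq_comm] using h

open Classical in
/-- The indicator modulo 2 of a set. -/
def parity (S : Set (ℤ × ℤ)) (u : ℤ × ℤ) : ZMod 2 := if u ∈ S then 1 else 0

/-- The indicator modulo 2 of the pairs with one element in `C` and one in `S`. -/
def crossing (C S : Set (ℤ × ℤ)) (u v : ℤ × ℤ) : ZMod 2 :=
  parity C u * parity S v + parity S u * parity C v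

theorem crossing_comm (C S : Set (ℤ × ℤ)) (u v : ℤ × ℤ) : crossing C S u v = crossing C S v u := by
  simp only [crossing]; ring

theorem crossing_eq_zero {C S : Set (ℤ × ℤ)} {u v : ℤ × ℤ} (hu : u ∉ C) (hv : v ∉ C) :
    crossing C S u v = 0 := by
  simp [crossing, parity, hu, hv]

theorem crossing_of_mem {C S : Set (ℤ × ℤ)} (hd : Disjoint C S) {u v : ℤ × ℤ} (hu : u ∈ C) :
    crossing C S u v = parity S v := by
  simp [crossing, parity, hu, disjoint_left.1 hd hu]

/-- The number modulo 2 of crossings of the horizontal ray to the right of `u`. -/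
def potential (C S : Set (ℤ × ℤ)) (N : ℤ) (u : ℤ × ℤ) : ZMod 2 :=
  ∑ j ∈ Finset.Ico u.1 N, crossing C S (j, u.2) (j + 1, u.2)

theorem zmod_two_add_self (a : ZMod 2) : a + a = 0 := CharTwo.add_self_eq_zero a

variable {C S : Set (ℤ × ℤ)} {N : ℤ}

theorem potential_eq_zero_of_le_fst {u : ℤ × ℤ} (hu : N ≤ u.1) : potential C S N u = 0 := by
  rw [potential, Finset.Ico_eq_empty (by omega), Finset.sum_empty]

theorem potential_eq_zero_of_le_snd (hC : ∀ u ∈ C, u.1 < N ∧ u.2 < N) {u : ℤ × ℤ}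
    (hu : N ≤ u.2) : potential C S N u = 0 := by
  refine Finset.sum_eq_zero fun j _ => crossing_eq_zero (fun h => ?_) fun h => ?_
  all_goals have := (hC _ h).2; simp only at this; omega

theorem potential_step_fst (hC : ∀ u ∈ C, u.1 < N ∧ u.2 < N) (x y : ℤ) :
    potential C S N (x, y) + potential C S N (x + 1, y) = crossing C S (x, y) (x + 1, y) := by
  by_cases hx : x < N
  · have h : potential C S N (x, y) =
        crossing C S (x, y) (x + 1, y) + potential C S N (x + 1, y) := by
      have hI : Finset.Ico x N = insert x (Finset.Ico (x + 1) N) := by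
        ext j
        simp only [Finset.mem_Ico, Finset.mem_insert]
        omega
      simp only [potential]
      rw [hI, Finset.sum_insert (by simp)]
    rw [h, add_assoc, zmod_two_add_self, add_zero]
  · rw [potential_eq_zero_of_le_fst (by simpa using hx),
      potential_eq_zero_of_le_fst (by simp; omega), crossing_eq_zero, add_zero]
    all_goals intro h; have := (hC _ h).1; simp only at this; omega

/-- If `v` is next to `u ∈ S` in a unit square meeting `C`, then `v` lies in `C` or in `S`. -/
def Tight (C S : Set (ℤ × ℤ)) : Prop :=
  ∀ u ∈ S, ∀ v, Rook u v → ∀ c ∈ C, King v c → v ∈ C ∨ v ∈ S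

/-- In a unit square meeting `C`, the crossing cochain is the coboundary of the indicator of `S`: by
`Tight`, an edge avoiding `C` has both ends in `S` or neither. -/
theorem crossing_eq_parity_add (hd : Disjoint C S) (hT : Tight C S) {u v c : ℤ × ℤ}
    (huv : Rook u v) (hc : c ∈ C) (hu : King u c) (hv : King v c) :
    crossing C S u v = parity S u + parity S v := by
  by_cases h1 : u ∈ C
  · rw [crossing_of_mem hd h1]; simp [parity, disjoint_left.1 hd h1]
  by_cases h2 : v ∈ C
  · rw [crossing_comm, crossing_of_mem hd h2]; simp [parity, disjoint_left.1 hd h2]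
  rw [crossing_eq_zero h1 h2]
  have h3 : u ∈ S ↔ v ∈ S :=
    ⟨fun h => (hT u h v huv c hc hv).resolve_left h2,
      fun h => (hT v h u huv.symm c hc hu).resolve_left h1⟩
  have h4 : parity S u = parity S v := by by_cases h : v ∈ S <;> simp [parity, h3, h]
  rw [h4, zmod_two_add_self]

/-- The cochain is closed. A square meeting `C` carries a coboundary, and any other square carries
zero. -/
theorem crossing_square (hd : Disjoint C S) (hT : Tight C S) (x y : ℤ) :
    crossing C S (x, y) (x + 1, y) + crossing C S (x, y + 1) (x + 1, y + 1) =
      crossing C S (x, y) (x, y + 1) + crossing C S (x + 1, y) (x + 1, y + 1) := by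
  by_cases h : ∃ c ∈ C, (c.1 = x ∨ c.1 = x + 1) ∧ (c.2 = y ∨ c.2 = y + 1)
  · obtain ⟨c, hc, h1, h2⟩ := h
    have key : ∀ u v : ℤ × ℤ, Rook u v → (u.1 = x ∨ u.1 = x + 1) → (u.2 = y ∨ u.2 = y + 1) →
        (v.1 = x ∨ v.1 = x + 1) → (v.2 = y ∨ v.2 = y + 1) →
        crossing C S u v = parity S u + parity S v := by
      intro u v huv a1 a2 a3 a4
      refine crossing_eq_parity_add hd hT huv hc ?_ ?_ <;>
        constructor <;> rw [abs_le] <;> omega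
    rw [key _ _ (by simp [Rook]) (by simp) (by simp) (by simp) (by simp),
      key _ _ (by simp [Rook]) (by simp) (by simp) (by simp) (by simp),
      key _ _ (by simp [Rook]) (by simp) (by simp) (by simp) (by simp),
      key _ _ (by simp [Rook]) (by simp) (by simp) (by simp) (by simp)]
    have e1 := zmod_two_add_self (parity S (x + 1, y))
    have e2 := zmod_two_add_self (parity S (x, y + 1))
    ring
  · have key : ∀ u : ℤ × ℤ, (u.1 = x ∨ u.1 = x + 1) → (u.2 = y ∨ u.2 = y + 1) → u ∉ C :=
      fun u h1 h2 h3 => h ⟨u, h3, h1, h2⟩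
    rw [crossing_eq_zero, crossing_eq_zero, crossing_eq_zero, crossing_eq_zero]
    all_goals exact key _ (by simp) (by simp)

/-- Horizontal steps hold by the definition of the potential; vertical ones propagate leftwards from
beyond `N`, where everything vanishes, by closedness on each square. -/
theorem potential_step_snd (hC : ∀ u ∈ C, u.1 < N ∧ u.2 < N) (hd : Disjoint C S)
    (hT : Tight C S) (x y : ℤ) :
    potential C S N (x, y) + potential C S N (x, y + 1) = crossing C S (x, y) (x, y + 1) := by
  have base : ∀ x, N ≤ x → potential C S N (x, y) + potential C S N (x, y + 1) =
      crossing C S (x, y) (x, y + 1) := by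
    intro x hx
    rw [potential_eq_zero_of_le_fst hx, potential_eq_zero_of_le_fst hx, crossing_eq_zero, add_zero]
    all_goals intro h; have := (hC _ h).1; simp only at this; omega
  rcases le_total N x with hx | hx
  · exact base x hx
  induction x, hx using Int.leInductionDown with
  | base => exact base N le_rfl
  | pred x hx ih =>
    have h1 := potential_step_fst (S := S) hC (x - 1) y
    have h2 := potential_step_fst (S := S) hC (x - 1) (y + 1)
    have h3 := crossing_square hd hT (x - 1) y
    rw [sub_add_cancel] at h1 h2 h3
    rw [← h1, ← h2, ← ih] at h3
    linear_combination h3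

theorem potential_add_of_rook (hC : ∀ u ∈ C, u.1 < N ∧ u.2 < N) (hd : Disjoint C S)
    (hT : Tight C S) {u v : ℤ × ℤ} (h : Rook u v) :
    potential C S N u + potential C S N v = crossing C S u v := by
  have self : ∀ u : ℤ × ℤ, potential C S N u + potential C S N u = crossing C S u u := by
    intro u
    rw [zmod_two_add_self, crossing, mul_comm, zmod_two_add_self]
  obtain ⟨x, y⟩ := u
  obtain ⟨x', y'⟩ := v
  simp only [Rook, abs_le] at h
  rcases h with ⟨rfl, h1, h2⟩ | ⟨rfl, h1, h2⟩
  · obtain rfl | rfl | rfl : x' = x ∨ x' = x + 1 ∨ x = x' + 1 := by omega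
    · exact self _
    · exact potential_step_fst hC _ _
    · rw [add_comm, crossing_comm]; exact potential_step_fst hC _ _
  · obtain rfl | rfl | rfl : y' = y ∨ y' = y + 1 ∨ y = y' + 1 := by omega
    · exact self _
    · exact potential_step_snd hC hd hT _ _
    · rw [add_comm, crossing_comm]; exact potential_step_snd hC hd hT _ _

/-- A diagonal step is replaced by two rook steps through the corner `(v.1, u.2)`. Both edges from
`C` to this corner have the same crossing value, the parity of the corner in `S`. -/
theorem potential_eq_of_king (hC : ∀ u ∈ C, u.1 < N ∧ u.2 < N) (hd : Disjoint C S)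
    (hT : Tight C S) {u v : ℤ × ℤ} (hu : u ∈ C) (hv : v ∈ C) (h : King u v) :
    potential C S N u = potential C S N v := by
  have h1 := potential_add_of_rook hC hd hT (u := u) (v := (v.1, u.2)) (Or.inl ⟨rfl, h.1⟩)
  have h2 := potential_add_of_rook hC hd hT (u := v) (v := (v.1, u.2))
    (Or.inr ⟨rfl, h.symm.2⟩)
  rw [crossing_of_mem hd hu] at h1
  rw [crossing_of_mem hd hv, ← h1] at h2
  exact (add_right_cancel h2).symm

/-- The relation `R` restricted to a set. -/
def RestrictRel {V : Type*} (R : V → V → Prop) (A : Set V) (u v : V) : Prop := R u v ∧ u ∈ A ∧ v ∈ A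

/-- The points outside `C` joined, outside `C`, to a point far to the right or far above. -/
def exterior (C : Set (ℤ × ℤ)) (N : ℤ) : Set (ℤ × ℤ) :=
  {u | u ∉ C ∧ ∃ v, Relation.ReflTransGen (RestrictRel Rook Cᶜ) u v ∧ (N ≤ v.1 ∨ N ≤ v.2)}

/-- The points of the exterior next to `C`. -/
def outerBoundary (C : Set (ℤ × ℤ)) (N : ℤ) : Set (ℤ × ℤ) :=
  {u | u ∈ exterior C N ∧ ∃ c ∈ C, King u c}

theorem mem_exterior_of_rook {u v : ℤ × ℤ} (hu : u ∈ exterior C N) (h : Rook u v) (hv : v ∉ C) :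
    v ∈ exterior C N := by
  obtain ⟨h1, w, hw, h2⟩ := hu
  exact ⟨hv, w, hw.head ⟨h.symm, hv, h1⟩, h2⟩

/-- Edges avoiding `C` have crossing zero, so the potential keeps its vanishing far value along any
path outside `C`. -/
theorem potential_eq_zero_of_mem_exterior (hC : ∀ u ∈ C, u.1 < N ∧ u.2 < N) (hd : Disjoint C S)
    (hT : Tight C S) {u : ℤ × ℤ} (hu : u ∈ exterior C N) : potential C S N u = 0 := by
  obtain ⟨-, w, hw, h2⟩ := hu
  induction hw using Relation.ReflTransGen.head_induction_on with
  | refl => exact h2.elim potential_eq_zero_of_le_fst (potential_eq_zero_of_le_snd hC)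
  | head h _ ih =>
    have := potential_add_of_rook hC hd hT h.1
    rw [crossing_eq_zero h.2.1 h.2.2, ih, add_zero] at this
    exact this

theorem mem_exterior_of_ray_right (x y : ℤ) (h : ∀ j, x ≤ j → (j, y) ∉ C) :
    (x, y) ∈ exterior C N := by
  rcases le_total N x with hx | hx
  · exact ⟨h x le_rfl, _, .refl, Or.inl hx⟩
  induction x, hx using Int.leInductionDown with
  | base => exact ⟨h N le_rfl, _, .refl, Or.inl le_rfl⟩
  | pred x hx ih =>
    refine mem_exterior_of_rook (ih fun j hj => h j (by omega)) ?_ (h _ le_rfl)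
    simp [Rook]

theorem mem_exterior_of_ray_up (x y : ℤ) (h : ∀ j, y ≤ j → (x, j) ∉ C) :
    (x, y) ∈ exterior C N := by
  rcases le_total N y with hy | hy
  · exact ⟨h y le_rfl, _, .refl, Or.inr hy⟩
  induction y, hy using Int.leInductionDown with
  | base => exact ⟨h N le_rfl, _, .refl, Or.inr le_rfl⟩
  | pred y hy ih =>
    refine mem_exterior_of_rook (ih fun j hj => h j (by omega)) ?_ (h _ le_rfl)
    simp [Rook]

theorem exists_last {p : ℤ → Prop} {N : ℤ} (hN : ∀ j, p j → j < N) {j₀ : ℤ} (h₀ : p j₀) :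
    ∃ k, j₀ ≤ k ∧ p k ∧ ∀ j, k + 1 ≤ j → ¬ p j := by
  obtain ⟨k, hk, hmax⟩ := Int.exists_greatest_of_bdd (P := p) ⟨N, fun z hz => (hN z hz).le⟩ ⟨j₀, h₀⟩
  exact ⟨k, hmax _ h₀, hk, fun j hj h => by have := hmax _ h; omega⟩

/-- Two points on the outer boundary of a finite king-connected set containing the origin and
`(M, 0)`, one on each positive half-axis, are joined by a rook-path inside the boundary. -/
theorem exists_rook_path_of_finite (hfin : C.Finite) {M : ℤ} (h0 : (0, 0) ∈ C) (hM : (M, 0) ∈ C)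
    (hconn : ∀ u ∈ C, Relation.ReflTransGen (RestrictRel King C) (0, 0) u) :
    ∃ k l : ℤ, M < k ∧ ∃ A : Set (ℤ × ℤ), (∀ u ∈ A, u ∉ C ∧ ∃ c ∈ C, King u c) ∧ (k, 0) ∈ A ∧
      Relation.ReflTransGen (RestrictRel Rook A) (k, 0) (0, l) := by
  obtain ⟨N, hC⟩ : ∃ N : ℤ, ∀ u ∈ C, u.1 < N ∧ u.2 < N := by
    obtain ⟨a, ha⟩ := hfin.bddAbove
    refine ⟨max a.1 a.2 + 1, fun u hu => ?_⟩
    have := ha hu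
    have h1 : u.1 ≤ a.1 := this.1
    have h2 : u.2 ≤ a.2 := this.2
    omega
  obtain ⟨k, hMk, hk, hk'⟩ := exists_last (p := fun j => (j, 0) ∈ C) (fun j h => (hC _ h).1) hM
  obtain ⟨l, -, hl, hl'⟩ := exists_last (p := fun j => (0, j) ∈ C) (fun j h => (hC _ h).2) h0
  have rk : Rook (k, 0) (k + 1, 0) := by simp [Rook]
  have rl : Rook (0, l) (0, l + 1) := by simp [Rook]
  have ha : (k + 1, 0) ∈ outerBoundary C N :=
    ⟨mem_exterior_of_ray_right _ _ hk', (k, 0), hk, by simp [King]⟩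
  have hb : (0, l + 1) ∈ exterior C N := mem_exterior_of_ray_up _ _ hl'
  -- `S` is only the rook-component of `(k + 1, 0)` in the outer boundary; it remains to show that
  -- `(0, l + 1)` belongs to it.
  set S : Set (ℤ × ℤ) :=
    {u | Relation.ReflTransGen (RestrictRel Rook (outerBoundary C N)) (k + 1, 0) u} with hS
  have hSb : S ⊆ outerBoundary C N := by
    intro u hu
    rcases Relation.ReflTransGen.cases_tail hu with h | ⟨v, -, h⟩
    · rw [h]; exact ha
    · exact h.2.2
  have hd : Disjoint C S := disjoint_left.2 fun u hu hu' => (hSb hu').1.1 hu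
  have hT : Tight C S := by
    intro u hu v huv c hc hvc
    by_cases hv : v ∈ C
    · exact Or.inl hv
    · exact Or.inr (Relation.ReflTransGen.tail hu ⟨huv, hSb hu,
        mem_exterior_of_rook (hSb hu).1 huv hv, c, hc, hvc⟩)
  have hconst : ∀ u ∈ C, potential C S N u = potential C S N (0, 0) := by
    intro u hu
    have := hconn u hu
    clear hu
    induction this with
    | refl => rfl
    | tail _ h ih => rw [← ih]; exact (potential_eq_of_king hC hd hT h.2.1 h.2.2 h.1).symm
  have e1 := potential_add_of_rook hC hd hT rk
  have e2 := potential_add_of_rook hC hd hT rl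
  rw [crossing_of_mem hd hk, hconst _ hk, potential_eq_zero_of_mem_exterior hC hd hT ha.1] at e1
  rw [crossing_of_mem hd hl, hconst _ hl, potential_eq_zero_of_mem_exterior hC hd hT hb, e1] at e2
  -- The constant potential on `C` equals the parity of either exit point in `S`; it is 1 at `(k +
  -- 1, 0)`, hence also at `(0, l + 1)`.
  have hbS : (0, l + 1) ∈ S := by
    by_contra hn
    have haS : (k + 1, 0) ∈ S := Relation.ReflTransGen.refl
    simp [parity, hn, haS] at e2
  exact ⟨k + 1, l + 1, by omega, outerBoundary C N, fun u hu => ⟨hu.1.1, hu.2⟩, ha, hbS⟩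

end Planar

/-! ### The lower bound -/

section Lower

variable {Ω : Type*} [MeasurableSpace Ω] {P : Measure Ω} {d : ℕ} {Φ : Ω → CountingConfig d}

/-- The cells of side `s` containing a point of the configuration. -/
def occupied (s : ℝ) (μ : CountingConfig d) : Set (Fin d → ℤ) := {z | μ.toMeasure (cell s z) ≠ 0}

theorem one_le_of_mem_occupied {s : ℝ} (hs : 0 < s) {μ : CountingConfig d} {z : Fin d → ℤ}
    (hz : z ∈ occupied s μ) : 1 ≤ μ.toMeasure (cell s z) := by
  obtain ⟨n, hn⟩ := μ.counting _ (isBounded_cell hs z) (measurableSet_cell s z)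
  have h0 : μ.toMeasure (cell s z) ≠ 0 := hz
  rw [hn] at h0 ⊢
  exact_mod_cast Nat.one_le_iff_ne_zero.2 (by exact_mod_cast h0)

theorem coveredSet_one (μ : CountingConfig d) (r : ℝ) :
    μ.coveredSet 1 r = {y | 1 ≤ μ.toMeasure (Metric.closedBall y r)} := by
  simp [CountingConfig.coveredSet, CountingConfig.coverage_eq]

theorem exists_occupied_of_mem_coveredSet {s : ℝ} (hs : 0 < s) {μ : CountingConfig d} {r : ℝ}
    {y : EuclideanSpace ℝ (Fin d)} (hy : y ∈ μ.coveredSet 1 r) :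
    ∃ z ∈ occupied s μ, y ∈ Metric.closedBall (corner s z) (r + √d * s) := by
  rw [coveredSet_one] at hy
  by_contra! hcon
  have h0 : μ.toMeasure (⋃ z, cell s z ∩ Metric.closedBall y r) = 0 := by
    refine measure_iUnion_null fun z => ?_
    by_contra hz
    obtain ⟨x, hx, hxy⟩ := nonempty_of_measure_ne_zero hz
    refine hcon z (fun h => hz (measure_mono_null inter_subset_left h)) ?_
    have h1 := dist_le_of_mem_closedCell hs (cell_subset_closedCell s z hx)
      (corner_mem_closedCell hs z)
    rw [Metric.mem_closedBall, dist_comm] at hxy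
    rw [Metric.mem_closedBall]
    linarith [dist_triangle y x (corner s z)]
  have hsub : Metric.closedBall y r ⊆ ⋃ z, cell s z ∩ Metric.closedBall y r := fun x hx => by
    obtain ⟨z, hz⟩ := exists_mem_cell hs x
    exact mem_iUnion.2 ⟨z, hz, hx⟩
  have h1 : (1 : ℝ≥0∞) ≤ μ.toMeasure (Metric.closedBall y r) := hy
  rw [measure_mono_null hsub h0] at h1
  simp at h1

/-- The lattice points at distance at most `ρ` from `s z`. -/
def nearCorners {s : ℝ} (hs : 0 < s) (ρ : ℝ) (z : Fin d → ℤ) : Finset (Fin d → ℤ) :=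
  (finite_setOf_dist_corner_le hs (corner s z) ρ).toFinset

theorem mem_nearCorners {s : ℝ} (hs : 0 < s) {ρ : ℝ} {z w : Fin d → ℤ} :
    w ∈ nearCorners hs ρ z ↔ dist (corner s w) (corner s z) ≤ ρ := by
  simp [nearCorners]

/-- If the covered set percolates, then from some cell start self-avoiding chains of occupied
cells of every length. -/
theorem exists_chains_of_percolates {s : ℝ} (hs : 0 < s) {μ : CountingConfig d} {r : ℝ}
    (hr : 0 ≤ r) (hd : 0 < d) (h : Percolates (μ.coveredSet 1 r)) :
    ∃ z, ∀ n, ∃ l ∈ chains (nearCorners hs (2 * (r + √d * s))) n z,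
      l.Nodup ∧ ∀ x ∈ l, x ∈ occupied s μ := by
  obtain ⟨T, hTsub, ⟨⟨y₀, hy₀⟩, hTc⟩, hTb⟩ := h
  have hR : 0 < r + √d * s := by positivity
  set R := r + √d * s with hRdef
  obtain ⟨z₀, hz₀, hyz₀⟩ := exists_occupied_of_mem_coveredSet hs (hTsub hy₀)
  let G : SimpleGraph (Fin d → ℤ) :=
    { Adj := fun u v => u ≠ v ∧ u ∈ occupied s μ ∧ v ∈ occupied s μ ∧
        dist (corner s u) (corner s v) ≤ 2 * R
      symm := ⟨fun u v h => ⟨h.1.symm, h.2.2.1, h.2.1, by rw [dist_comm]; exact h.2.2.2⟩⟩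
      loopless := ⟨fun u h => h.1 rfl⟩ }
  set S := {z | z ∈ occupied s μ ∧ G.Reachable z₀ z}
  set S' := {z | z ∈ occupied s μ ∧ ¬ G.Reachable z₀ z}
  have hsub : T ⊆ (⋃ z ∈ S, Metric.closedBall (corner s z) R) ∪
      ⋃ z ∈ S', Metric.closedBall (corner s z) R := by
    intro y hy
    obtain ⟨z, hz, hyz⟩ := exists_occupied_of_mem_coveredSet hs (hTsub hy)
    by_cases h : G.Reachable z₀ z
    · exact Or.inl (mem_iUnion₂.2 ⟨z, ⟨hz, h⟩, hyz⟩)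
    · exact Or.inr (mem_iUnion₂.2 ⟨z, ⟨hz, h⟩, hyz⟩)
  -- The balls of the component of `z₀` and those of the other occupied cells form two closed sets
  -- covering `T`. If `T` met both, connectedness would give a common point, placing two corners
  -- within `2R` and merging the components.
  have hTS : T ⊆ ⋃ z ∈ S, Metric.closedBall (corner s z) R := by
    intro y hy
    by_contra hyS
    obtain ⟨x, -, hx, hx'⟩ := isPreconnected_closed_iff.1 hTc _ _
      (isClosed_biUnion_closedBall_corner hs R S) (isClosed_biUnion_closedBall_corner hs R S') hsub
      ⟨y₀, hy₀, mem_iUnion₂.2 ⟨z₀, ⟨hz₀, SimpleGraph.Reachable.refl _⟩, hyz₀⟩⟩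
      ⟨y, hy, (hsub hy).resolve_left hyS⟩
    obtain ⟨u, hu, hxu⟩ := mem_iUnion₂.1 hx
    obtain ⟨v, hv, hxv⟩ := mem_iUnion₂.1 hx'
    refine hv.2 (hu.2.trans (SimpleGraph.Adj.reachable ⟨?_, hu.1, hv.1, ?_⟩))
    · rintro rfl
      exact hv.2 hu.2
    · have := dist_triangle_left (corner s u) (corner s v) x
      rw [Metric.mem_closedBall] at hxu hxv
      linarith
  refine ⟨z₀, fun n => ?_⟩
  obtain ⟨z, hz, hfar⟩ : ∃ z ∈ S, 2 * R * n ≤ dist (corner s z₀) (corner s z) := by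
    by_contra! hcon
    refine hTb (Metric.isBounded_closedBall (x := corner s z₀) (r := 2 * R * n + R) |>.subset ?_)
    intro y hy
    obtain ⟨z, hz, hyz⟩ := mem_iUnion₂.1 (hTS hy)
    have h1 := hcon z hz
    have h2 := dist_triangle y (corner s z) (corner s z₀)
    rw [dist_comm] at h1
    rw [Metric.mem_closedBall] at hyz ⊢
    linarith
  refine exists_nodup_chain (G := G) (fun u v huv => ⟨?_, huv.2.2.1⟩) (corner s)
    (by positivity : 0 < 2 * R) (fun u v huv => huv.2.2.2) hz₀ hz.2 n hfar
  rw [mem_nearCorners, dist_comm]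
  exact huv.2.2.2

theorem measure_all_occupied_le (hΦ : Measurable Φ) {lam : ℝ} (hint : HasIntensity P Φ lam)
    (hsub : IsAlphaWeaklySubPoisson P Φ) {s : ℝ} (hs : 0 < s) (l : List (Fin d → ℤ))
    (hl : l.Nodup) :
    P {ω | ∀ x ∈ l, x ∈ occupied s (Φ ω)} ≤
      (ENNReal.ofReal lam * ENNReal.ofReal s ^ d) ^ l.length := by
  have hB : ∀ i : Fin l.length, Bornology.IsBounded (cell s (l.get i)) :=
    fun i => isBounded_cell hs _
  have hm : ∀ i : Fin l.length, MeasurableSet (cell s (l.get i)) := fun i => measurableSet_cell s _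
  have h1 := hsub l.length (fun i => cell s (l.get i)) hB hm fun i j hij =>
    disjoint_cell hs fun h => hij (List.nodup_iff_injective_get.1 hl h)
  have h2 : ∀ i : Fin l.length, ∫⁻ ω, (Φ ω).toMeasure (cell s (l.get i)) ∂P =
      ENNReal.ofReal lam * ENNReal.ofReal s ^ d := fun i => by
    rw [hint _ (hB i) (hm i), volume_cell]
  simp only [h2, Finset.prod_const, Finset.card_univ, Fintype.card_fin] at h1
  refine le_trans ?_ h1
  have hmeas : Measurable fun ω => ∏ i : Fin l.length, (Φ ω).toMeasure (cell s (l.get i)) :=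
    Finset.measurable_fun_prod _ fun i _ => (CountingConfig.measurable_apply (hB i) (hm i)).comp hΦ
  -- Counts are integers, so the product is at least 1 when all cells are occupied; Markov's
  -- inequality at level 1 applies.
  refine le_trans (measure_mono ?_) ((one_mul _).ge.trans (mul_meas_ge_le_lintegral hmeas 1))
  intro ω hω
  exact Finset.one_le_prod'' fun i => one_le_of_mem_occupied hs (hω _ (List.get_mem l i))

theorem measure_percolates_eq_zero (hΦ : Measurable Φ) (hd : 0 < d) {lam : ℝ} (hlam : 0 < lam)
    (hint : HasIntensity P Φ lam) (hsub : IsAlphaWeaklySubPoisson P Φ) {r : ℝ} (hr : 0 ≤ r)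
    {s : ℝ} (hs : 0 < s)
    (hlt : lam * ((2 * (r + √d * s) + √d * s) ^ d * unitBallVolume d) < 1) :
    P {ω | Percolates ((Φ ω).coveredSet 1 r)} = 0 := by
  set ρ := 2 * (r + √d * s) with hρ
  have hρ0 : 0 ≤ ρ + √d * s := by positivity
  have hθ : ENNReal.ofReal (unitBallVolume d) =
      volume (Metric.ball (0 : EuclideanSpace ℝ (Fin d)) 1) :=
    ENNReal.ofReal_toReal Metric.isBounded_ball.measure_lt_top.ne
  have hcard : ∀ z : Fin d → ℤ, ((nearCorners hs ρ z).card : ℝ≥0∞) * ENNReal.ofReal s ^ d ≤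
      ENNReal.ofReal ((ρ + √d * s) ^ d * unitBallVolume d) := by
    intro z
    refine (card_corner_le hs (corner s z) (ρ := ρ) _
      fun w hw => (mem_nearCorners hs).1 hw).trans (le_of_eq ?_)
    rw [Measure.addHaar_closedBall _ _ hρ0, ENNReal.ofReal_mul (by positivity), hθ]
    simp
  have hbdd : BddAbove (range fun z : Fin d → ℤ => (nearCorners hs ρ z).card) := by
    have hs' : ENNReal.ofReal s ^ d ≠ 0 := pow_ne_zero _ (by simpa using hs)
    have hs'' : ENNReal.ofReal s ^ d ≠ ∞ := ENNReal.pow_ne_top ENNReal.ofReal_ne_top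
    obtain ⟨n, hn⟩ := ENNReal.exists_nat_gt (ENNReal.div_ne_top (ENNReal.ofReal_ne_top
      (r := (ρ + √d * s) ^ d * unitBallVolume d)) hs')
    refine ⟨n, ?_⟩
    rintro _ ⟨z, rfl⟩
    have := (ENNReal.le_div_iff_mul_le (Or.inl hs') (Or.inl hs'')).2 (hcard z)
    exact_mod_cast (this.trans hn.le)
  -- Choosing `N` as an attained maximum, not a rounded-up bound, lets the volume estimate at `z₁`
  -- apply to `N` itself.
  obtain ⟨z₁, hz₁⟩ : ∃ z₁ : Fin d → ℤ, ∀ z,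
      (nearCorners hs ρ z).card ≤ (nearCorners hs ρ z₁).card := by
    obtain ⟨z₁, hz₁⟩ := Nat.sSup_mem (range_nonempty _) hbdd
    exact ⟨z₁, fun z => (le_csSup hbdd ⟨z, rfl⟩).trans hz₁.ge⟩
  set N := (nearCorners hs ρ z₁).card
  set p := ENNReal.ofReal lam * ENNReal.ofReal s ^ d with hp
  have hNp : N * p < 1 := by
    calc (N : ℝ≥0∞) * p = ENNReal.ofReal lam * (N * ENNReal.ofReal s ^ d) := by rw [hp]; ring
      _ ≤ ENNReal.ofReal lam * ENNReal.ofReal ((ρ + √d * s) ^ d * unitBallVolume d) := by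
        gcongr; exact hcard z₁
      _ = ENNReal.ofReal (lam * ((ρ + √d * s) ^ d * unitBallVolume d)) :=
        (ENNReal.ofReal_mul hlam.le).symm
      _ < 1 := by rw [ENNReal.ofReal_lt_one]; exact hlt
  have hp' : p ≠ ∞ :=
    ENNReal.mul_ne_top ENNReal.ofReal_ne_top (ENNReal.pow_ne_top ENNReal.ofReal_ne_top)
  have hnull : ∀ z, P {ω | ∀ n, ∃ l ∈ chains (nearCorners hs ρ) n z,
      l.Nodup ∧ ∀ x ∈ l, x ∈ occupied s (Φ ω)} = 0 := by
    intro z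
    have hle : ∀ n, P {ω | ∀ n, ∃ l ∈ chains (nearCorners hs ρ) n z,
        l.Nodup ∧ ∀ x ∈ l, x ∈ occupied s (Φ ω)} ≤ (N * p) ^ n * p := by
      intro n
      have hn : {ω | ∀ n, ∃ l ∈ chains (nearCorners hs ρ) n z,
          l.Nodup ∧ ∀ x ∈ l, x ∈ occupied s (Φ ω)} ⊆ {ω | ∃ l ∈ chains (nearCorners hs ρ) n z,
          l.Nodup ∧ ∀ x ∈ l, x ∈ occupied s (Φ ω)} := fun ω hω => hω n
      refine (measure_mono hn).trans ((measure_exists_chain_le P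
        (fun ω => occupied s (Φ ω)) (measure_all_occupied_le hΦ hint hsub hs) hz₁ n z).trans
        (le_of_eq ?_))
      rw [mul_pow, pow_succ]
      ring
    have hlim : Filter.Tendsto (fun n : ℕ => (N * p) ^ n * p) Filter.atTop (nhds 0) := by
      have := ENNReal.Tendsto.mul_const (ENNReal.tendsto_pow_atTop_nhds_zero_of_lt_one hNp)
        (Or.inr hp')
      rwa [zero_mul] at this
    exact le_antisymm (ge_of_tendsto' hlim hle) zero_le
  refine measure_mono_null (fun ω hω => ?_) (measure_iUnion_null hnull)
  exact mem_iUnion.2 (exists_chains_of_percolates hs hr hd hω)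

theorem unitBallVolume_pos (d : ℕ) : 0 < unitBallVolume d :=
  ENNReal.toReal_pos (Metric.measure_ball_pos _ _ one_pos).ne'
    Metric.isBounded_ball.measure_lt_top.ne

theorem le_criticalRadius (hΦ : Measurable Φ) (hd : 0 < d) {lam : ℝ} (hlam : 0 < lam)
    (hint : HasIntensity P Φ lam) (hsub : IsAlphaWeaklySubPoisson P Φ) :
    ENNReal.ofReal ((1 / 2) * (1 / (lam * unitBallVolume d) ^ (1 / (d : ℝ)))) ≤
      criticalRadius P Φ 1 := by
  refine le_sInf ?_
  rintro _ ⟨r, hr, rfl, hpos⟩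
  refine ENNReal.ofReal_le_ofReal ?_
  by_contra! hlt
  have hV : 0 < lam * unitBallVolume d := mul_pos hlam (unitBallVolume_pos d)
  set t := (lam * unitBallVolume d) ^ (1 / (d : ℝ)) with ht
  have ht0 : 0 < t := Real.rpow_pos_of_pos hV _
  have htd : t ^ d = lam * unitBallVolume d := by
    rw [ht, one_div]
    exact Real.rpow_inv_natCast_pow hV.le hd.ne'
  have h1 : t * (2 * r) < 1 := by
    have : r * t < 1 / 2 := by
      calc r * t < 1 / 2 * (1 / t) * t := by gcongr
        _ = 1 / 2 := by field_simp
    linarith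
  -- As `s → 0` the radius in the volume bound tends to `2r`, and `t * (2r) < 1` is strict, so some
  -- positive `s` works.
  have hcont : Filter.Tendsto (fun s : ℝ => t * (2 * (r + √d * s) + √d * s)) (nhds 0)
      (nhds (t * (2 * (r + √d * 0) + √d * 0))) := by
    apply Continuous.tendsto
    fun_prop
  simp only [mul_zero, add_zero] at hcont
  have hev := (hcont.eventually (gt_mem_nhds h1)).filter_mono
    (nhdsWithin_le_nhds (s := Ioi (0 : ℝ)))
  obtain ⟨s, hs1, hs0⟩ := (hev.and self_mem_nhdsWithin).exists
  refine hpos.ne' (measure_percolates_eq_zero hΦ hd hlam hint hsub hr (s := s) hs0 ?_)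
  have hs0' : 0 < s := hs0
  have : (t * (2 * (r + √d * s) + √d * s)) ^ d < 1 := pow_lt_one₀ (by positivity) hs1 hd.ne'
  rw [mul_pow, htd] at this
  linarith

end Lower

/-! ### The upper bound -/

section Upper

variable {Ω : Type*} [MeasurableSpace Ω] {P : Measure Ω} {d : ℕ} {Φ : Ω → CountingConfig d}

/-- The plane spanned by the first two coordinates. -/
def planeEmbed (d : ℕ) (u : ℤ × ℤ) : Fin d → ℤ :=
  fun i => if i.val = 0 then u.1 else if i.val = 1 then u.2 else 0

theorem planeEmbed_injective (hd : 2 ≤ d) : Function.Injective (planeEmbed d) := by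
  intro u v h
  have h0 := congrFun h ⟨0, by omega⟩
  have h1 := congrFun h ⟨1, by omega⟩
  simp only [planeEmbed] at h0 h1
  exact Prod.ext (by simpa using h0) (by simpa using h1)

theorem abs_planeEmbed_sub_le {u v : ℤ × ℤ} (h : King u v) (i : Fin d) :
    |planeEmbed d u i - planeEmbed d v i| ≤ 1 := by
  simp only [planeEmbed]
  split_ifs
  · exact h.1
  · exact h.2
  · simp

/-- The cells of the plane containing no point of the configuration. -/
def vacant (s : ℝ) (μ : CountingConfig d) : Set (ℤ × ℤ) :=
  {u | μ.toMeasure (cell s (planeEmbed d u)) = 0}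

theorem measure_all_vacant_le (hd : 2 ≤ d) {lam : ℝ} (hlam : 0 < lam) (hint : HasIntensity P Φ lam)
    (hsub : IsNuWeaklySubPoisson P Φ) {s : ℝ} (hs : 0 < s) (l : List (ℤ × ℤ)) (hl : l.Nodup) :
    P {ω | ∀ x ∈ l, x ∈ vacant s (Φ ω)} ≤ ENNReal.ofReal (Real.exp (-(lam * s ^ d))) ^ l.length := by
  classical
  set F := l.toFinset.image (planeEmbed d) with hF
  have hcard : F.card = l.length := by
    rw [hF, Finset.card_image_of_injective _ (planeEmbed_injective hd),
      List.toFinset_card_of_nodup hl]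
  have hb : Bornology.IsBounded (⋃ z ∈ F, cell s z) :=
    (Bornology.isBounded_biUnion_finset F).2 fun z _ => isBounded_cell hs z
  have hm : MeasurableSet (⋃ z ∈ F, cell s z) :=
    Finset.measurableSet_biUnion F fun z _ => measurableSet_cell s z
  have hE : ENNReal.ofReal lam * (l.length * ENNReal.ofReal s ^ d) =
      ENNReal.ofReal (l.length * (lam * s ^ d)) := by
    rw [ENNReal.ofReal_mul (by positivity), ENNReal.ofReal_mul hlam.le, ENNReal.ofReal_pow hs.le,
      ENNReal.ofReal_natCast]
    ring
  have h1 := hsub _ hb hm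
  rw [hint _ hb hm, volume_biUnion_cell hs, hcard, hE, EReal.coe_ennreal_ofReal,
    max_eq_left (by positivity), ← EReal.coe_neg, EReal.exp_coe] at h1
  refine (measure_mono fun ω hω => ?_).trans (h1.trans (le_of_eq ?_))
  · change (Φ ω).toMeasure _ = 0
    refine (measure_biUnion_null_iff F.countable_toSet).2 fun z hz => ?_
    obtain ⟨x, hx, rfl⟩ := Finset.mem_image.1 hz
    exact hω x (List.mem_toFinset.1 hx)
  · rw [← ENNReal.ofReal_pow (Real.exp_pos _).le, ← Real.exp_nat_mul]
    congr 2
    ring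

theorem isConnected_closedCell {s : ℝ} (hs : 0 < s) (z : Fin d → ℤ) :
    IsConnected (closedCell s z) := by
  refine ⟨⟨_, corner_mem_closedCell hs z⟩, Convex.isPreconnected ?_⟩
  intro x hx y hy a b ha hb hab i
  exact convex_Icc (s * z i : ℝ) (s * (z i + 1)) (hx i) (hy i) ha hb hab

theorem closedCell_inter_nonempty {s : ℝ} (hs : 0 < s) {z w : Fin d → ℤ}
    (h : ∀ i, |z i - w i| ≤ 1) : (closedCell s z ∩ closedCell s w).Nonempty := by
  refine ⟨corner s fun i => max (z i) (w i), fun i => ?_, fun i => ?_⟩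
  all_goals
    have h1 := abs_le.1 (h i)
    simp only [corner]
    constructor
    · gcongr
      simp
    · refine mul_le_mul_of_nonneg_left ?_ hs.le
      norm_cast
      omega

/-- The points joined to `u` inside `A` for the king-adjacency. -/
def kingCluster (A : Set (ℤ × ℤ)) (u : ℤ × ℤ) : Set (ℤ × ℤ) :=
  {v | Relation.ReflTransGen (RestrictRel King A) u v}

theorem mem_of_mem_kingCluster {A : Set (ℤ × ℤ)} {u v : ℤ × ℤ} (hu : u ∈ A)
    (hv : v ∈ kingCluster A u) : v ∈ A := by
  rcases Relation.ReflTransGen.cases_tail hv with rfl | ⟨w, -, h⟩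
  · exact hu
  · exact h.2.2

theorem percolates_of_infinite_kingCluster (hd : 2 ≤ d) {s : ℝ} (hs : 0 < s) {μ : CountingConfig d}
    {u : ℤ × ℤ} (hinf : (kingCluster (vacant s μ)ᶜ u).Infinite) :
    Percolates (μ.coveredSet 1 (√d * s)) := by
  set K := kingCluster (vacant s μ)ᶜ u with hK
  have huK : u ∈ K := Relation.ReflTransGen.refl
  -- A cluster contains its base point even when that point is outside the set; a second element
  -- forces a genuine step out of `u`.
  have hu : u ∈ (vacant s μ)ᶜ := by
    obtain ⟨v, hv, hvu⟩ := hinf.exists_notMem_finset {u}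
    rcases Relation.ReflTransGen.cases_head hv with h | ⟨w, h, -⟩
    · simp [h] at hvu
    · exact h.2.1
  refine ⟨⋃ v ∈ K, closedCell s (planeEmbed d v), iUnion₂_subset fun v hv y hy => ?_, ?_, ?_⟩
  · rw [coveredSet_one]
    refine (one_le_of_mem_occupied hs (mem_of_mem_kingCluster hu hv)).trans (measure_mono ?_)
    intro x hx
    exact dist_le_of_mem_closedCell hs (cell_subset_closedCell s _ hx) hy
  -- Both directions are needed because the chain relation asks for membership of its left end only.
  · have key : ∀ v ∈ K,
        Relation.ReflTransGen (fun i j => (closedCell s (planeEmbed d i) ∩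
          closedCell s (planeEmbed d j)).Nonempty ∧ i ∈ K) u v ∧
        Relation.ReflTransGen (fun i j => (closedCell s (planeEmbed d i) ∩
          closedCell s (planeEmbed d j)).Nonempty ∧ i ∈ K) v u := by
      intro v hv
      induction hv with
      | refl => exact ⟨.refl, .refl⟩
      | @tail b c hb h ih =>
        exact ⟨ih.1.tail ⟨closedCell_inter_nonempty hs (abs_planeEmbed_sub_le h.1), hb⟩,
          ih.2.head ⟨closedCell_inter_nonempty hs (abs_planeEmbed_sub_le h.1.symm), hb.tail h⟩⟩
    exact IsConnected.biUnion_of_reflTransGen ⟨u, huK⟩ (fun v _ => isConnected_closedCell hs _)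
      fun v hv w hw => (key v hv).2.trans (key w hw).1
  · intro hb
    obtain ⟨ρ, hρ⟩ := hb.subset_closedBall 0
    refine hinf (((finite_setOf_dist_corner_le hs (0 : EuclideanSpace ℝ (Fin d)) ρ).preimage
      (planeEmbed_injective hd).injOn).subset fun v hv => ?_)
    exact hρ (mem_iUnion₂.2 ⟨v, hv, corner_mem_closedCell hs _⟩)

theorem finite_setOf_king (b : ℤ × ℤ) : {u | King b u}.Finite := by
  refine (Set.finite_Icc (b - 1) (b + 1)).subset fun u hu => ?_
  have h1 := abs_le.1 hu.1
  have h2 := abs_le.1 hu.2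
  refine ⟨⟨?_, ?_⟩, ⟨?_, ?_⟩⟩ <;> simp <;> omega

/-- Adding finitely many points to a set all of whose clusters are finite keeps the clusters
finite. -/
theorem finite_kingCluster_union {A B : Set (ℤ × ℤ)} (hA : ∀ u, (kingCluster A u).Finite)
    (hB : B.Finite) {u : ℤ × ℤ} (hu : u ∈ B) : (kingCluster (A ∪ B) u).Finite := by
  -- After its last visit to `B`, a path steps to a king-neighbour `w` of some `b ∈ B` and stays in
  -- the `A`-cluster of `w`.
  have hfin : (B ∪ ⋃ b ∈ B, ⋃ w ∈ {w | King b w}, kingCluster A w).Finite :=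
    hB.union (hB.biUnion fun b _ => (finite_setOf_king b).biUnion fun w _ => hA w)
  refine hfin.subset fun v hv => ?_
  induction hv with
  | refl => exact Or.inl hu
  | @tail x y _ h ih =>
    by_cases hyB : y ∈ B
    · exact Or.inl hyB
    have hyA : y ∈ A := h.2.2.resolve_right hyB
    refine Or.inr ?_
    by_cases hxB : x ∈ B
    · exact mem_iUnion₂.2 ⟨x, hxB, mem_iUnion₂.2 ⟨y, h.1, .refl⟩⟩
    · have hxA : x ∈ A := h.2.1.resolve_right hxB
      obtain ⟨b, hb, hx⟩ := mem_iUnion₂.1 (ih.resolve_left hxB)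
      obtain ⟨w, hw, hx⟩ := mem_iUnion₂.1 hx
      exact mem_iUnion₂.2 ⟨b, hb, mem_iUnion₂.2 ⟨w, hw, hx.tail ⟨h.1, hxA, hyA⟩⟩⟩

/-- The four rook-neighbours. -/
def rookNeighbors (u : ℤ × ℤ) : Finset (ℤ × ℤ) :=
  {(u.1 + 1, u.2), (u.1 - 1, u.2), (u.1, u.2 + 1), (u.1, u.2 - 1)}

theorem card_rookNeighbors_le (u : ℤ × ℤ) : (rookNeighbors u).card ≤ 4 := Finset.card_le_four

theorem mem_rookNeighbors {u v : ℤ × ℤ} (hne : u ≠ v) (h : Rook u v) : v ∈ rookNeighbors u := by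
  obtain ⟨x, y⟩ := u
  obtain ⟨x', y'⟩ := v
  simp only [Rook, abs_le, ne_eq, Prod.mk.injEq] at h hne
  simp only [rookNeighbors, Finset.mem_insert, Finset.mem_singleton, Prod.mk.injEq]
  omega

/-- If all clusters of `A` are finite, there is a long self-avoiding chain outside `A` starting
far away on the horizontal half-axis. -/
theorem exists_chain_compl_of_finite_kingCluster {A : Set (ℤ × ℤ)}
    (hA : ∀ u, (kingCluster A u).Finite) (M : ℕ) :
    ∃ k : ℕ, M < k ∧ ∃ l ∈ chains rookNeighbors k ((k : ℤ), 0), l.Nodup ∧ ∀ x ∈ l, x ∈ Aᶜ := by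
  -- Adding the segment from the origin to `(M, 0)` forces the surrounding path to cross the
  -- half-axis beyond `M`.
  set B : Set (ℤ × ℤ) := Icc 0 (M : ℤ) ×ˢ {0} with hB
  have hBfin : B.Finite := (Set.finite_Icc _ _).prod (Set.finite_singleton _)
  have h0B : ((0, 0) : ℤ × ℤ) ∈ B := by simp [hB]
  set C := kingCluster (A ∪ B) (0, 0) with hC
  have hCfin : C.Finite := finite_kingCluster_union hA hBfin h0B
  have h0C : (0, 0) ∈ C := Relation.ReflTransGen.refl
  have hMC : ∀ j : ℕ, j ≤ M → ((j : ℤ), (0 : ℤ)) ∈ C := by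
    intro j
    induction j with
    | zero => intro _; exact_mod_cast h0C
    | succ j ih =>
      intro hj
      refine Relation.ReflTransGen.tail (ih (by omega)) ⟨?_, Or.inr ?_, Or.inr ?_⟩
      · simp [King]
      · simp [hB]; omega
      · simp [hB]; omega
  have hconn : ∀ u ∈ C, Relation.ReflTransGen (RestrictRel King C) (0, 0) u := by
    intro u hu
    induction hu with
    | refl => exact .refl
    | tail hb h ih => exact ih.tail ⟨h.1, hb, hb.tail h⟩
  obtain ⟨k, l, hk, S, hS, hkS, hpath⟩ :=
    exists_rook_path_of_finite hCfin h0C (hMC M le_rfl) hconn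
  lift k to ℕ using by omega
  refine ⟨k, by omega, ?_⟩
  let G : SimpleGraph (ℤ × ℤ) :=
    { Adj := fun u v => u ≠ v ∧ RestrictRel Rook S u v
      symm := ⟨fun u v h => ⟨h.1.symm, h.2.1.symm, h.2.2.2, h.2.2.1⟩⟩
      loopless := ⟨fun u h => h.1 rfl⟩ }
  have hreach : ∀ w, Relation.ReflTransGen (RestrictRel Rook S) ((k : ℤ), 0) w →
      G.Reachable ((k : ℤ), 0) w := by
    intro w hw
    induction hw with
    | refl => exact SimpleGraph.Reachable.refl _
    | @tail x y _ h ih =>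
      by_cases hxy : x = y
      · exact hxy ▸ ih
      · exact ih.trans (SimpleGraph.Adj.reachable ⟨hxy, h⟩)
  -- The path runs from abscissa `k` to abscissa 0 in steps of at most 1, so it makes at least `k`
  -- steps.
  obtain ⟨L, hL, hnd, hLS⟩ := exists_nodup_chain (G := G) (nbr := rookNeighbors) (A := S)
    (fun u v h => ⟨mem_rookNeighbors h.1 h.2.1, h.2.2.2⟩) (fun u => (u.1 : ℝ)) one_pos
    (fun u v h => by
      have : |u.1 - v.1| ≤ 1 := by
        rcases h.2.1 with h | h
        · exact h.2
        · simp [h.1]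
      rw [Real.dist_eq]
      exact_mod_cast this) hkS (hreach _ hpath) k (by simp)
  refine ⟨L, hL, hnd, fun x hx hxA => ?_⟩
  -- A boundary point in `A` would be king-adjacent to the cluster `C`, hence in it.
  obtain ⟨hxC, c, hc, hxc⟩ := hS x (hLS x hx)
  exact hxC (Relation.ReflTransGen.tail hc
    ⟨hxc.symm, mem_of_mem_kingCluster (Or.inr h0B) hc, Or.inl hxA⟩)

theorem measure_percolates_pos [IsProbabilityMeasure P] (hd : 2 ≤ d) {lam : ℝ} (hlam : 0 < lam)
    (hint : HasIntensity P Φ lam) (hsub : IsNuWeaklySubPoisson P Φ) {s : ℝ} (hs : 0 < s)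
    (hlt : Real.log 4 < lam * s ^ d) :
    0 < P {ω | Percolates ((Φ ω).coveredSet 1 (√d * s))} := by
  set q := ENNReal.ofReal (Real.exp (-(lam * s ^ d))) with hq
  have h4q : 4 * q < 1 := by
    have h1 : Real.exp (-(lam * s ^ d)) < 4⁻¹ := by
      rw [Real.exp_neg]
      refine inv_strictAnti₀ (by norm_num) ?_
      rwa [← Real.log_lt_iff_lt_exp (by norm_num)]
    have h2 : (4 : ℝ≥0∞) = ENNReal.ofReal 4 := by simp
    rw [h2, hq, ← ENNReal.ofReal_mul (by norm_num), ENNReal.ofReal_lt_one]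
    linarith
  set f : ℕ → ℝ≥0∞ := fun n => ((4 : ℕ) : ℝ≥0∞) ^ n * q ^ (n + 1) with hf
  have hsum : ∑' n, f n ≠ ∞ := by
    have : ∀ n, f n = (4 * q) ^ n * q := fun n => by
      simp only [hf, mul_pow, pow_succ]; push_cast; ring
    rw [tsum_congr this, ENNReal.tsum_mul_right, ENNReal.tsum_geometric]
    exact ENNReal.mul_ne_top (ENNReal.inv_ne_top.2 (tsub_pos_of_lt h4q).ne') ENNReal.ofReal_ne_top
  obtain ⟨m, hm1, hm2⟩ := (((ENNReal.tendsto_sum_nat_add f hsum).eventually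
    (gt_mem_nhds one_pos)).and (Filter.eventually_ge_atTop 1)).exists
  by_contra hzero
  have hzero' := le_zero_iff.1 (not_lt.1 hzero)
  set E : ℕ → Set Ω := fun n => {ω | ∃ l ∈ chains rookNeighbors n ((n : ℤ), 0),
    l.Nodup ∧ ∀ x ∈ l, x ∈ vacant s (Φ ω)} with hE
  have hEle : ∀ n, P (E n) ≤ f n := fun n => measure_exists_chain_le P (fun ω => vacant s (Φ ω))
    (measure_all_vacant_le hd hlam hint hsub hs) card_rookNeighbors_le n _
  have hcover : (univ : Set Ω) ⊆
      {ω | Percolates ((Φ ω).coveredSet 1 (√d * s))} ∪ ⋃ n, E (n + m) := by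
    intro ω _
    by_cases h : ∀ u, (kingCluster (vacant s (Φ ω))ᶜ u).Finite
    · obtain ⟨k, hk, l, hl⟩ := exists_chain_compl_of_finite_kingCluster h m
      rw [compl_compl] at hl
      refine Or.inr (mem_iUnion.2 ⟨k - m, ?_⟩)
      rw [Nat.sub_add_cancel hk.le]
      exact ⟨l, hl⟩
    · push Not at h
      obtain ⟨u, hu⟩ := h
      exact Or.inl (percolates_of_infinite_kingCluster hd hs hu)
  -- Only subadditivity is used, so the percolation event need not be measurable.
  have h1 : (1 : ℝ≥0∞) ≤ ∑' n, f (n + m) := by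
    calc (1 : ℝ≥0∞) = P univ := measure_univ.symm
      _ ≤ P {ω | Percolates ((Φ ω).coveredSet 1 (√d * s))} + P (⋃ n, E (n + m)) :=
        (measure_mono hcover).trans (measure_union_le _ _)
      _ ≤ ∑' n, f (n + m) := by
        rw [hzero', zero_add]
        exact (measure_iUnion_le _).trans (ENNReal.tsum_le_tsum fun n => hEle _)
  exact absurd h1 (not_le.2 hm1)

theorem criticalRadius_le [IsProbabilityMeasure P] (hd : 2 ≤ d) {lam : ℝ} (hlam : 0 < lam)
    (hint : HasIntensity P Φ lam) (hsub : IsNuWeaklySubPoisson P Φ) :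
    criticalRadius P Φ 1 ≤
      ENNReal.ofReal (√d * (Real.log (3 ^ d - 2) / lam) ^ (1 / (d : ℝ))) := by
  have hd0 : 0 < √(d : ℝ) := Real.sqrt_pos.2 (by exact_mod_cast (by omega : 0 < d))
  have h3 : (4 : ℝ) ≤ 3 ^ d - 2 := by
    have : (3 : ℝ) ^ 2 ≤ 3 ^ d := pow_le_pow_right₀ (by norm_num) hd
    linarith
  have hlog : Real.log 4 ≤ Real.log (3 ^ d - 2) := Real.log_le_log (by norm_num) h3
  have hlog0 : 0 ≤ Real.log (3 ^ d - 2) / lam :=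
    div_nonneg (Real.log_nonneg (by linarith)) hlam.le
  set t := (Real.log (3 ^ d - 2) / lam) ^ (1 / (d : ℝ)) with ht
  have ht0 : 0 ≤ t := Real.rpow_nonneg hlog0 _
  have htd : t ^ d = Real.log (3 ^ d - 2) / lam := by
    rw [ht, one_div]
    exact Real.rpow_inv_natCast_pow hlog0 (by omega)
  by_contra! hcon
  obtain ⟨r, hr1, hr2⟩ := ENNReal.lt_iff_exists_nnreal_btwn.1 hcon
  rw [← ENNReal.ofReal_coe_nnreal] at hr1 hr2
  have hr : √d * t < r := (ENNReal.ofReal_lt_ofReal_iff_of_nonneg (by positivity)).1 hr1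
  -- The cube side is `s = r / √d`, for which the covering radius `√d s` is exactly `r`.
  have hts : t < r / √d := by rwa [lt_div_iff₀ hd0, mul_comm]
  have hs : (0 : ℝ) < r / √d := ht0.trans_lt hts
  refine absurd hr2 (not_lt.2 (sInf_le ⟨r, r.2, rfl, ?_⟩))
  have := measure_percolates_pos hd hlam hint hsub hs ?_
  · rwa [mul_div_cancel₀ _ hd0.ne'] at this
  · refine hlog.trans_lt ?_
    have h5 := pow_lt_pow_left₀ hts ht0 (by omega : d ≠ 0)
    rw [htd, div_lt_iff₀ hlam] at h5
    linarith

end Upper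

end

theorem mainTheorem3 {Ω : Type*} [MeasurableSpace Ω] (P : Measure Ω) [IsProbabilityMeasure P]
    (d : ℕ) (hd : 2 ≤ d) (Φ : Ω → CountingConfig d) (hΦ : Measurable Φ)
    (lam : ℝ) (hlam : 0 < lam) (hint : HasIntensity P Φ lam)
    (hstat : IsStationaryProcess P Φ) (hsub : IsWeaklySubPoisson P Φ) :
    0 < (1 / 2) * (1 / (lam * unitBallVolume d) ^ (1 / (d : ℝ))) ∧
    ENNReal.ofReal ((1 / 2) * (1 / (lam * unitBallVolume d) ^ (1 / (d : ℝ)))) ≤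
      criticalRadius P Φ 1 ∧
    criticalRadius P Φ 1 ≤
      ENNReal.ofReal (Real.sqrt d * (Real.log (3 ^ d - 2) / lam) ^ (1 / (d : ℝ))) ∧
    criticalRadius P Φ 1 < ∞ := by
  have hd0 : 0 < d := by omega
  have hle := criticalRadius_le hd hlam hint hsub.1
  refine ⟨?_, le_criticalRadius hΦ hd0 hlam hint hsub.2, hle,
    hle.trans_lt ENNReal.ofReal_lt_top⟩
  have : 0 < (lam * unitBallVolume d) ^ (1 / (d : ℝ)) :=
    Real.rpow_pos_of_pos (mul_pos hlam (unitBallVolume_pos d)) _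
  positivity
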